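/- **Theorem (Balog–Szemerédi–Gowers lemma for differential entropy).** For a random vector $U$ with a density $f_U$ with respect to Lebesgue measure let $h(U)=E[-\log f_U(U)]$; for jointly continuous $U,V$ let $h(U|V)=E[-\log (f_{U,V}(U,V)/f_V(V))]$ and $I(U;V)=h(U)+h(V)-h(U,V)$. Let $X,Y$ be real-valued random variables with a joint density such that $h(X)$, $h(Y)$, $h(X,Y)$ and $h(X+Y)$ exist and are finite. Suppose that, for some $K\ge 1$, $$I(X;Y)\le \log K,\qquad\text{i.e.}\qquad h(X,Y)\ge h(X)+h(Y)-\log K,$$ and $$h(X+Y)\le \tfrac12 h(X)+\tfrac12 h(Y)+\log K .$$ Let $X_2,Y_1,X_1,Y'$ be real-valued random variables that form, in this order, a Markov chain, and such that each of the pairs $(X_2,Y_1)$, $(X_1,Y_1)$ and $(X_1,Y')$ has the same distribution as $(X,Y)$. Then the three conditional differential entropies below exist and are finite, and $$h(X_2\,|\,X_1,Y_1)\ge h(X)-\log K,$$ $$h(Y'\,|\,X_1,Y_1)\ge h(Y)-\log K,$$ $$h(X_2+Y'\,|\,X_1,Y_1)\le \tfrac12 h(X)+\tfrac12 h(Y)+7\log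 K .$$ -/

import Mathlib

open MeasureTheory ProbabilityTheory

noncomputable section

/-- The differential entropy `h(X) = E[-log f(X)]` of a continuous random variable or vector `X`
with density `f` with respect to Lebesgue measure. Meaningful under `HasFiniteDiffEntropy`. -/
def diffEntropy {Ω E : Type*} [MeasurableSpace Ω] [MeasureSpace E]
    (X : Ω → E) (P : Measure Ω) : ℝ :=
  ∫ ω, -Real.log (pdf X P volume (X ω)).toReal ∂P

/-- `X` is continuous (it has a density with respect to Lebesgue measure) and its differential
entropy exists and is finite. -/
def HasFiniteDiffEntropy {Ω E : Type*} [MeasurableSpace Ω] [MeasureSpace E]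
    (X : Ω → E) (P : Measure Ω) : Prop :=
  HasPDF X P volume ∧ Integrable (fun ω => -Real.log (pdf X P volume (X ω)).toReal) P

/-- The conditional density `f(u | v) = f(u, v) / f(v)` of `U` given `V`, evaluated at the random
point `(U, V)`. -/
def condPdfAt {Ω E F : Type*} [MeasurableSpace Ω] [MeasureSpace E] [MeasureSpace F]
    (U : Ω → E) (V : Ω → F) (P : Measure Ω) (ω : Ω) : ℝ :=
  (pdf (fun ω => (U ω, V ω)) P volume (U ω, V ω)).toReal / (pdf V P volume (V ω)).toReal

/-- The conditional differential entropy `h(U | V) = E[-log f(U | V)]`. Meaningful under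
`HasFiniteCondDiffEntropy`. -/
def condDiffEntropy {Ω E F : Type*} [MeasurableSpace Ω] [MeasureSpace E] [MeasureSpace F]
    (U : Ω → E) (V : Ω → F) (P : Measure Ω) : ℝ :=
  ∫ ω, -Real.log (condPdfAt U V P ω) ∂P

/-- `V` and `(U, V)` are continuous random vectors, and the conditional differential entropy
`h(U | V)` exists and is finite. -/
def HasFiniteCondDiffEntropy {Ω E F : Type*} [MeasurableSpace Ω] [MeasureSpace E] [MeasureSpace F]
    (U : Ω → E) (V : Ω → F) (P : Measure Ω) : Prop :=
  HasPDF V P volume ∧ HasPDF (fun ω => (U ω, V ω)) P volume ∧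
    Integrable (fun ω => -Real.log (condPdfAt U V P ω)) P

/-- The mutual information `I(X; Y) = h(X) + h(Y) - h(X, Y)` of continuous random vectors. -/
def mutualInfo {Ω E F : Type*} [MeasurableSpace Ω] [MeasureSpace E] [MeasureSpace F]
    (X : Ω → E) (Y : Ω → F) (P : Measure Ω) : ℝ :=
  diffEntropy X P + diffEntropy Y P - diffEntropy (fun ω => (X ω, Y ω)) P

/-- `A, B, C` is a Markov chain, that is, `A` and `C` are conditionally independent given `B`: the
conditional distribution of `C` given `(A, B)` is almost surely that of `C` given `B`. -/
def IsMarkovTriple {Ω α β γ : Type*} [MeasurableSpace Ω] [MeasurableSpace α] [MeasurableSpace β]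
    [MeasurableSpace γ] [StandardBorelSpace γ] [Nonempty γ]
    (A : Ω → α) (B : Ω → β) (C : Ω → γ) (P : Measure Ω) [IsFiniteMeasure P] : Prop :=
  ∀ᵐ ω ∂P, condDistrib C (fun ω => (A ω, B ω)) P (A ω, B ω) = condDistrib C B P (B ω)

/-- The real random variables `A, B, C, D` form a Markov chain: each one depends on its past only
through its immediate predecessor. -/
def IsMarkovChain {Ω : Type*} [MeasurableSpace Ω] (A B C D : Ω → ℝ)
    (P : Measure Ω) [IsFiniteMeasure P] : Prop :=
  IsMarkovTriple A B C P ∧ IsMarkovTriple (fun ω => (A ω, B ω)) C D P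

end

/-!
The conditional entropies `h(X₂ | X₁, Y₁)` and `h(Y' | X₁, Y₁)` equal `h(X, Y) - h(Y)` and
`h(X, Y) - h(X)` by the Markov property, so the first two bounds restate the assumption on
`I(X; Y)`.

For the third, let `(T, S)` be a copy of `(X₁, Y₁)` that is conditionally independent of it given
`(X₂, Y')` (`exists_condIndep_copy`). Since `X₂ + Y' = (X₂ + S) - (T + S) + (T + Y')`, the triple
`(X₂ + Y', X₁, Y₁)` is a function both of `(X₁, Y₁, X₂, Y')` and of
`(X₁, Y₁, X₂ + S, T + S, T + Y')`, and these two vectors together determine all six variables by a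
volume-preserving linear map. Submodularity gives
`h(X₂ + Y', X₁, Y₁) + h(X₁, Y₁, S, T, X₂, Y') ≤ h(X₁, Y₁, X₂, Y') + h(X, Y) + 3 h(X + Y)`.
By conditional independence the joint entropy of the six variables is
`2 h(X₁, Y₁, X₂, Y') - h(X₂, Y')`; moreover `h(X₁, Y₁, X₂, Y') = 3 h(X, Y) - h(X) - h(Y)` by the
Markov property, and `h(X₂, Y') ≤ h(X) + h(Y)`. Altogether
`h(X₂ + Y' | X₁, Y₁) ≤ 3 h(X + Y) + 2 h(X) + 2 h(Y) - 3 h(X, Y)`, which the hypotheses bound by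
`h(X) / 2 + h(Y) / 2 + 6 log K` (`integral_log_condSum`).

Finiteness of the entropies has to be proved along with the inequalities, so submodularity is not
used as a black box. Each inequality comes from a weight `R ≥ 0`, a quotient of products of
densities, with `E[R] ≤ 1` and `log R ≤ R - 1`. The bounds `E[R] ≤ 1` are Tonelli computations with
explicit densities (`lintegral_condSum_div_le_one`, `lintegral_copy_weight_le_one`,
`lintegral_indep_div_le_one`). They enclose the logarithm of the conditional density of `X₂ + Y'`
between two integrable functions, which gives integrability and the upper bound at once.
-/

open scoped ENNReal

/-! ### Random variables with an explicit density -/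

/-- `d` is a (measurable) density of the law of `U` under `P`. In contrast to `pdf U P volume`, which
is only determined almost everywhere, `d` is an explicit function. -/
structure HasDensity {Ω E : Type*} [MeasurableSpace Ω] [MeasureSpace E]
    (U : Ω → E) (P : Measure Ω) (d : E → ℝ≥0∞) : Prop where
  aemeasurable : AEMeasurable U P
  measurable : Measurable d
  map_eq : P.map U = volume.withDensity d

namespace HasDensity

variable {Ω Ω' E F : Type*} [MeasurableSpace Ω] [MeasurableSpace Ω'] [MeasureSpace E]
  [MeasureSpace F] {P : Measure Ω} {P' : Measure Ω'} {U : Ω → E} {d : E → ℝ≥0∞}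

theorem lintegral_comp (h : HasDensity U P d) {φ : E → ℝ≥0∞} (hφ : Measurable φ) :
    ∫⁻ ω, φ (U ω) ∂P = ∫⁻ u, φ u * d u := by
  rw [← lintegral_map' hφ.aemeasurable h.aemeasurable, h.map_eq,
    lintegral_withDensity_eq_lintegral_mul _ h.measurable hφ]
  simp [mul_comm]

theorem of_lintegral (hU : AEMeasurable U P) (hd : Measurable d)
    (h : ∀ φ : E → ℝ≥0∞, Measurable φ → ∫⁻ ω, φ (U ω) ∂P = ∫⁻ u, φ u * d u) :
    HasDensity U P d := by
  refine ⟨hU, hd, Measure.ext_of_lintegral _ fun φ hφ => ?_⟩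
  rw [lintegral_map' hφ.aemeasurable hU, h φ hφ,
    lintegral_withDensity_eq_lintegral_mul _ hd hφ]
  simp [mul_comm]

theorem of_hasPDF (h : HasPDF U P volume) : HasDensity U P (pdf U P volume) :=
  ⟨HasPDF.aemeasurable U P volume, measurable_pdf _ _ _, map_eq_withDensity_pdf U P volume⟩

theorem hasPDF (h : HasDensity U P d) : HasPDF U P volume :=
  hasPDF_of_map_eq_withDensity h.aemeasurable d h.measurable.aemeasurable h.map_eq

theorem lintegral_eq_one [IsProbabilityMeasure P] (h : HasDensity U P d) : ∫⁻ u, d u = 1 := by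
  simpa using (h.lintegral_comp (φ := fun _ => 1) measurable_const).symm

theorem ae_of_ae_volume (h : HasDensity U P d) {p : E → Prop} (hp : ∀ᵐ u, p u) :
    ∀ᵐ ω ∂P, p (U ω) := by
  refine ae_of_ae_map h.aemeasurable ?_
  rw [h.map_eq]
  exact (withDensity_absolutelyContinuous _ _).ae_le hp

/-- Along its own law a density is almost surely positive and finite. -/
theorem ae_pos_lt_top [IsProbabilityMeasure P] (h : HasDensity U P d) :
    ∀ᵐ ω ∂P, d (U ω) ≠ 0 ∧ d (U ω) ≠ ∞ := by
  refine Filter.Eventually.and ?_ ?_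
  · refine ae_of_ae_map h.aemeasurable (p := fun u => d u ≠ 0) ?_
    rw [h.map_eq, ae_withDensity_iff h.measurable]
    exact Filter.Eventually.of_forall fun _ h => h
  · refine h.ae_of_ae_volume (p := fun u => d u ≠ ∞) ?_
    filter_upwards [ae_lt_top h.measurable (by rw [h.lintegral_eq_one]; simp)] with u hu
    exact hu.ne

theorem pdf_ae_eq [IsProbabilityMeasure P] [SigmaFinite (volume : Measure E)]
    (h : HasDensity U P d) : ∀ᵐ ω ∂P, pdf U P volume (U ω) = d (U ω) := by
  refine h.ae_of_ae_volume (p := fun u => pdf U P volume u = d u) ?_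
  rw [pdf_def, h.map_eq]
  exact Measure.rnDeriv_withDensity _ h.measurable

theorem of_identDistrib {V : Ω' → E} (h : HasDensity U P d) (hV : IdentDistrib V U P' P) :
    HasDensity V P' d :=
  ⟨hV.aemeasurable_fst, h.measurable, hV.map_eq.trans h.map_eq⟩

theorem identDistrib {V : Ω' → E} (hV : HasDensity V P' d) (h : HasDensity U P d) :
    IdentDistrib V U P' P :=
  ⟨hV.aemeasurable, h.aemeasurable, hV.map_eq.trans h.map_eq.symm⟩

theorem fst [SFinite (volume : Measure E)] [SFinite (volume : Measure F)] {V : Ω → F}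
    {d : E × F → ℝ≥0∞} (h : HasDensity (fun ω => (U ω, V ω)) P d) :
    HasDensity U P (fun u => ∫⁻ v, d (u, v)) := by
  refine of_lintegral (measurable_fst.comp_aemeasurable h.aemeasurable)
    h.measurable.lintegral_prod_right' fun φ hφ => ?_
  have hm := h.measurable
  rw [h.lintegral_comp (φ := fun x => φ x.1) (by fun_prop), Measure.volume_eq_prod,
    lintegral_prod _ (by fun_prop)]
  refine lintegral_congr fun u => ?_
  exact lintegral_const_mul (φ u) (hm.comp measurable_prodMk_left)

theorem snd [SFinite (volume : Measure E)] [SFinite (volume : Measure F)] {V : Ω → F}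
    {d : E × F → ℝ≥0∞} (h : HasDensity (fun ω => (U ω, V ω)) P d) :
    HasDensity V P (fun v => ∫⁻ u, d (u, v)) := by
  refine of_lintegral (measurable_snd.comp_aemeasurable h.aemeasurable)
    h.measurable.lintegral_prod_left' fun φ hφ => ?_
  have hm := h.measurable
  rw [h.lintegral_comp (φ := fun x => φ x.2) (by fun_prop), Measure.volume_eq_prod,
    lintegral_prod_symm _ (by fun_prop)]
  refine lintegral_congr fun u => ?_
  exact lintegral_const_mul (φ u) (hm.comp measurable_prodMk_right)

/-- The differential entropy computed from an explicit density. -/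
theorem integral_log [IsProbabilityMeasure P] [SigmaFinite (volume : Measure E)]
    (h : HasDensity U P d) (hU : HasFiniteDiffEntropy U P) :
    Integrable (fun ω => Real.log (d (U ω)).toReal) P ∧
      ∫ ω, Real.log (d (U ω)).toReal ∂P = -diffEntropy U P := by
  have hae : (fun ω => Real.log (pdf U P volume (U ω)).toReal) =ᵐ[P]
      fun ω => Real.log (d (U ω)).toReal := by
    filter_upwards [h.pdf_ae_eq] with ω hω
    rw [hω]
  constructor
  · rw [← integrable_congr hae]
    simpa using hU.2.neg
  · rw [← integral_congr_ae hae, diffEntropy, integral_neg, neg_neg]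

theorem integral_log_transfer {V : Ω' → E} {c : ℝ} (hV : HasDensity V P' d) (h : HasDensity U P d)
    (hi : Integrable (fun ω => Real.log (d (U ω)).toReal) P ∧
      ∫ ω, Real.log (d (U ω)).toReal ∂P = c) :
    Integrable (fun ω => Real.log (d (V ω)).toReal) P' ∧
      ∫ ω, Real.log (d (V ω)).toReal ∂P' = c := by
  have hid : IdentDistrib (fun ω => Real.log (d (V ω)).toReal)
      (fun ω => Real.log (d (U ω)).toReal) P' P :=
    (hV.identDistrib h).comp (u := fun u => Real.log (d u).toReal)
      (h.measurable.ennreal_toReal.log)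
  rw [hid.integrable_iff, hid.integral_eq]
  exact hi

/-- Along its own law a density is almost surely a nonzero real number. -/
theorem ae_toReal_ne_zero [IsProbabilityMeasure P] (h : HasDensity U P d) :
    ∀ᵐ ω ∂P, (d (U ω)).toReal ≠ 0 := by
  filter_upwards [h.ae_pos_lt_top] with ω hω
  exact ENNReal.toReal_ne_zero.2 hω

/-- Passage to another probability space that carries a copy of `U`. -/
theorem comp_transfer {V : Ω' → E} {φ : E → F} {e : F → ℝ≥0∞} (hV : HasDensity V P' d)
    (h : HasDensity U P d) (hφ : Measurable φ) (hφU : HasDensity (fun ω => φ (U ω)) P e) :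
    HasDensity (fun ω => φ (V ω)) P' e :=
  hφU.of_identDistrib ((hV.identDistrib h).comp hφ)

end HasDensity

/-! ### The density of a Markov chain -/

theorem ENNReal.lintegral_div_self_le_one {α : Type*} [MeasurableSpace α] {μ : Measure α}
    {u : α → ℝ≥0∞} (hu : Measurable u) : ∫⁻ a, u a / (∫⁻ a, u a ∂μ) ∂μ ≤ 1 := by
  simp only [div_eq_mul_inv]
  rw [lintegral_mul_const _ hu]
  exact ENNReal.mul_inv_le_one _

/-- Normalizing `u` to mass one and scaling back by its mass changes nothing, even when that mass
vanishes. -/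
theorem ENNReal.mass_mul_lintegral_div {α : Type*} [MeasurableSpace α] {μ : Measure α}
    {u φ : α → ℝ≥0∞} (hu : Measurable u) (hφ : Measurable φ) (hm : ∫⁻ a, u a ∂μ ≠ ∞) :
    (∫⁻ a, u a ∂μ) * ∫⁻ a, φ a * (u a / (∫⁻ a, u a ∂μ)) ∂μ = ∫⁻ a, φ a * u a ∂μ := by
  by_cases h0 : ∫⁻ a, u a ∂μ = 0
  · rw [h0, zero_mul]
    have := (lintegral_eq_zero_iff hu).1 h0
    refine Eq.symm ((lintegral_congr_ae ?_).trans (lintegral_zero (μ := μ)))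
    filter_upwards [this] with a ha
    simp [ha]
  · rw [← lintegral_const_mul _ (by fun_prop)]
    refine lintegral_congr fun a => ?_
    rw [div_eq_mul_inv, mul_comm (φ a), mul_comm (u a), mul_assoc, ← mul_assoc,
      ENNReal.mul_inv_cancel h0 hm, one_mul, mul_comm]

/-- The density of a Markov triple: the conditional density of `C` given `(A, B)` is that of `C`
given `B`. -/
theorem HasDensity.of_isMarkovTriple {Ω α β γ : Type*} [MeasurableSpace Ω] [MeasureSpace α]
    [MeasureSpace β] [MeasureSpace γ] [StandardBorelSpace γ] [Nonempty γ]
    [SFinite (volume : Measure α)] [SFinite (volume : Measure β)] [SFinite (volume : Measure γ)]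
    {P : Measure Ω} [IsProbabilityMeasure P] {A : Ω → α} {B : Ω → β} {C : Ω → γ}
    {fAB : α × β → ℝ≥0∞} {fBC : β × γ → ℝ≥0∞}
    (hAB : HasDensity (fun ω => (A ω, B ω)) P fAB) (hBC : HasDensity (fun ω => (B ω, C ω)) P fBC)
    (hM : IsMarkovTriple A B C P) :
    HasDensity (fun ω => ((A ω, B ω), C ω)) P
      (fun x => fAB x.1 * (fBC (x.1.2, x.2) / ∫⁻ c, fBC (x.1.2, c))) := by
  have hmAB := hAB.measurable
  have hmBC := hBC.measurable
  have hB := hBC.fst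
  have hmB := hB.measurable
  have hC : AEMeasurable C P := measurable_snd.comp_aemeasurable hBC.aemeasurable
  have hk : Measurable (Function.uncurry fun (b : β) (c : γ) => fBC (b, c) / ∫⁻ c, fBC (b, c)) :=
    hmBC.div (hmB.comp measurable_fst)
  let η : Kernel β γ := Kernel.withDensity (Kernel.const β volume)
    (fun b c => fBC (b, c) / ∫⁻ c, fBC (b, c))
  have hηl (b : β) {φ : γ → ℝ≥0∞} (hφ : Measurable φ) :
      ∫⁻ c, φ c ∂(η b) = ∫⁻ c, φ c * (fBC (b, c) / ∫⁻ c, fBC (b, c)) := by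
    rw [Kernel.lintegral_withDensity _ hk _ hφ]
    simp [mul_comm]
  -- The normalized density has mass at most one at every `b`, also where the mass of
  -- `fBC (b, ·)` is `0` or `∞`.
  have hη : IsFiniteKernel η := by
    refine ⟨1, ENNReal.one_lt_top, fun b => ?_⟩
    rw [← lintegral_one, hηl b measurable_const]
    simp only [one_mul]
    exact ENNReal.lintegral_div_self_le_one (by fun_prop)
  have hcond : condDistrib C B P =ᵐ[P.map B] η := by
    refine condDistrib_ae_eq_of_measure_eq_compProd B hC ?_
    refine Measure.ext_of_lintegral _ fun φ hφ => ?_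
    rw [lintegral_map' hφ.aemeasurable hBC.aemeasurable, Measure.lintegral_compProd hφ,
      hBC.lintegral_comp hφ, hB.map_eq, lintegral_withDensity_eq_lintegral_mul _ hmB
        (hφ.lintegral_kernel_prod_right'), Measure.volume_eq_prod,
      lintegral_prod _ (by fun_prop)]
    have hfin := ae_lt_top hmB (by rw [hB.lintegral_eq_one]; simp)
    refine lintegral_congr_ae ?_
    filter_upwards [hfin] with b hb
    simp only [Pi.mul_apply]
    rw [hηl b (by fun_prop)]
    exact (ENNReal.mass_mul_lintegral_div (by fun_prop) (by fun_prop) hb.ne).symm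
  have hcond' := ae_of_ae_map hB.aemeasurable hcond
  refine HasDensity.of_lintegral (hAB.aemeasurable.prodMk hC)
    ((hmAB.comp measurable_fst).mul (hk.comp (measurable_fst.snd.prodMk measurable_snd)))
    fun φ hφ => ?_
  calc ∫⁻ ω, φ ((A ω, B ω), C ω) ∂P
      = ∫⁻ x, φ x ∂(P.map fun ω => ((A ω, B ω), C ω)) :=
        (lintegral_map' hφ.aemeasurable (hAB.aemeasurable.prodMk hC)).symm
    _ = ∫⁻ x, ∫⁻ c, φ (x, c) ∂(condDistrib C (fun ω => (A ω, B ω)) P x)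
          ∂(P.map fun ω => (A ω, B ω)) := by
        rw [← compProd_map_condDistrib hC, Measure.lintegral_compProd hφ]
    _ = ∫⁻ ω, ∫⁻ c, φ ((A ω, B ω), c) ∂(condDistrib C (fun ω => (A ω, B ω)) P (A ω, B ω)) ∂P :=
        lintegral_map' hφ.lintegral_kernel_prod_right'.aemeasurable hAB.aemeasurable
    _ = ∫⁻ ω, (∫⁻ c, φ ((A ω, B ω), c) * (fBC (B ω, c) / ∫⁻ c, fBC (B ω, c))) ∂P := by
        refine lintegral_congr_ae ?_
        filter_upwards [hM, hcond'] with ω h1 h2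
        rw [h1, h2, hηl _ (by fun_prop)]
    _ = ∫⁻ x : α × β, (∫⁻ c, φ (x, c) * (fBC (x.2, c) / ∫⁻ c, fBC (x.2, c))) * fAB x := by
        refine hAB.lintegral_comp
          (φ := fun x => ∫⁻ c, φ (x, c) * (fBC (x.2, c) / ∫⁻ c, fBC (x.2, c))) ?_
        exact (hφ.mul (hk.comp (measurable_fst.snd.prodMk measurable_snd))).lintegral_prod_right'
    _ = _ := by
        rw [Measure.volume_eq_prod (α × β) γ, lintegral_prod]
        · refine lintegral_congr fun x => ?_
          rw [← lintegral_mul_const]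
          · refine lintegral_congr fun c => ?_
            ring
          · exact (hφ.comp (measurable_const.prodMk measurable_id)).mul
              (hk.comp (measurable_const.prodMk measurable_id))
        · exact (hφ.mul ((hmAB.comp measurable_fst).mul
            (hk.comp (measurable_fst.snd.prodMk measurable_snd)))).aemeasurable

/-! ### Marginals and linear changes of variables -/

namespace HasDensity

variable {Ω E F G : Type*} [MeasurableSpace Ω] [MeasureSpace E] [MeasureSpace F] [MeasureSpace G]
  [SFinite (volume : Measure E)] [SFinite (volume : Measure F)] [SFinite (volume : Measure G)]
  {P : Measure Ω} {U : Ω → E} {V : Ω → F} {B : Ω → G} {d : (E × F) × G → ℝ≥0∞}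

theorem fst_prodMk (h : HasDensity (fun ω => ((U ω, V ω), B ω)) P d) :
    HasDensity (fun ω => (U ω, B ω)) P (fun x => ∫⁻ v, d ((x.1, v), x.2)) := by
  have hm := h.measurable
  have hd : Measurable fun x : E × G => ∫⁻ v, d ((x.1, v), x.2) :=
    Measurable.lintegral_prod_right' (f := fun y : (E × G) × F => d ((y.1.1, y.2), y.1.2))
      (by fun_prop)
  refine of_lintegral ((measurable_fst.fst.prodMk measurable_snd).comp_aemeasurable h.aemeasurable)
    hd fun φ hφ => ?_
  rw [h.lintegral_comp (φ := fun x => φ (x.1.1, x.2)) (by fun_prop), Measure.volume_eq_prod,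
    lintegral_prod_symm _ (by fun_prop), Measure.volume_eq_prod E G,
    lintegral_prod_symm _ (by fun_prop)]
  refine lintegral_congr fun b => ?_
  rw [Measure.volume_eq_prod, lintegral_prod _ (by fun_prop)]
  refine lintegral_congr fun u => ?_
  exact lintegral_const_mul (φ (u, b)) (hm.comp (by fun_prop))

theorem snd_prodMk (h : HasDensity (fun ω => ((U ω, V ω), B ω)) P d) :
    HasDensity (fun ω => (V ω, B ω)) P (fun x => ∫⁻ u, d ((u, x.1), x.2)) := by
  have hm := h.measurable
  have hd : Measurable fun x : F × G => ∫⁻ u, d ((u, x.1), x.2) :=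
    Measurable.lintegral_prod_right' (f := fun y : (F × G) × E => d ((y.2, y.1.1), y.1.2))
      (by fun_prop)
  refine of_lintegral ((measurable_fst.snd.prodMk measurable_snd).comp_aemeasurable h.aemeasurable)
    hd fun φ hφ => ?_
  rw [h.lintegral_comp (φ := fun x => φ (x.1.2, x.2)) (by fun_prop), Measure.volume_eq_prod,
    lintegral_prod_symm _ (by fun_prop), Measure.volume_eq_prod F G,
    lintegral_prod_symm _ (by fun_prop)]
  refine lintegral_congr fun b => ?_
  rw [Measure.volume_eq_prod, lintegral_prod_symm _ (by fun_prop)]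
  refine lintegral_congr fun u => ?_
  exact lintegral_const_mul (φ (u, b)) (hm.comp (by fun_prop))

theorem swap {d : E × F → ℝ≥0∞} (h : HasDensity (fun ω => (U ω, V ω)) P d) :
    HasDensity (fun ω => (V ω, U ω)) P (fun x => d (x.2, x.1)) := by
  have hm := h.measurable
  refine of_lintegral (measurable_swap.comp_aemeasurable h.aemeasurable)
    (hm.comp measurable_swap) fun φ hφ => ?_
  rw [h.lintegral_comp (φ := fun x => φ (x.2, x.1)) (by fun_prop), Measure.volume_eq_prod,
    Measure.volume_eq_prod, ← lintegral_prod_swap]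
  rfl

/-- The shear `(u, v) ↦ (u, u + v)` preserves Lebesgue measure. -/
theorem shear {U V : Ω → ℝ} {d : (ℝ × ℝ) × G → ℝ≥0∞}
    (h : HasDensity (fun ω => ((U ω, V ω), B ω)) P d) :
    HasDensity (fun ω => ((U ω, U ω + V ω), B ω)) P
      (fun x => d ((x.1.1, x.1.2 - x.1.1), x.2)) := by
  have hm := h.measurable
  have hs : Measurable fun x : (ℝ × ℝ) × G => ((x.1.1, x.1.1 + x.1.2), x.2) := by fun_prop
  refine of_lintegral (hs.comp_aemeasurable h.aemeasurable) (by fun_prop) fun φ hφ => ?_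
  rw [h.lintegral_comp (φ := fun x => φ ((x.1.1, x.1.1 + x.1.2), x.2)) (by fun_prop),
    Measure.volume_eq_prod, lintegral_prod_symm _ (by fun_prop), lintegral_prod_symm _ (by fun_prop)]
  refine lintegral_congr fun b => ?_
  rw [Measure.volume_eq_prod, lintegral_prod _ (by fun_prop), lintegral_prod _ (by fun_prop)]
  refine lintegral_congr fun u => ?_
  simpa using lintegral_add_left_eq_self (μ := volume)
    (fun z => φ ((u, z), b) * d ((u, z - u), b)) u

end HasDensity

/-! ### Conditional entropy from densities -/

/-- It suffices to know the quotient of the two densities along `(U, V)`, almost surely. -/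
theorem condDiffEntropy_of_density {Ω E F : Type*} [MeasurableSpace Ω] [MeasureSpace E]
    [MeasureSpace F] [SigmaFinite (volume : Measure E)] [SigmaFinite (volume : Measure F)]
    {P : Measure Ω} [IsProbabilityMeasure P] {U : Ω → E} {V : Ω → F} {d : E × F → ℝ≥0∞}
    {e : F → ℝ≥0∞} (hUV : HasDensity (fun ω => (U ω, V ω)) P d) (hV : HasDensity V P e)
    {r : Ω → ℝ≥0∞} (hr : ∀ᵐ ω ∂P, d (U ω, V ω) / e (V ω) = r ω)
    (hint : Integrable (fun ω => Real.log (r ω).toReal) P) :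
    HasFiniteCondDiffEntropy U V P ∧
      condDiffEntropy U V P = -∫ ω, Real.log (r ω).toReal ∂P := by
  have hae : (fun ω => Real.log (condPdfAt U V P ω)) =ᵐ[P] fun ω => Real.log (r ω).toReal := by
    filter_upwards [hUV.pdf_ae_eq, hV.pdf_ae_eq, hr] with ω h1 h2 h3
    rw [condPdfAt, h1, h2, ← ENNReal.toReal_div, h3]
  refine ⟨⟨hV.hasPDF, hUV.hasPDF, (integrable_congr hae).2 hint |>.neg⟩, ?_⟩
  rw [condDiffEntropy, integral_neg, integral_congr_ae hae]

/-! ### The joint density of the four-term chain -/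

/-- The density of `((X₂, Y'), (X₁, Y₁))` when `X₂, Y₁, X₁, Y'` is a Markov chain in which each of
`(X₂, Y₁)`, `(X₁, Y₁)` and `(X₁, Y')` has density `f`. -/
noncomputable def chainDensity (f : ℝ × ℝ → ℝ≥0∞) (w : (ℝ × ℝ) × (ℝ × ℝ)) : ℝ≥0∞ :=
  f (w.1.1, w.2.2) / (∫⁻ x, f (x, w.2.2)) * f w.2 * (f (w.2.1, w.1.2) / ∫⁻ y, f (w.2.1, y))

theorem measurable_chainDensity {f : ℝ × ℝ → ℝ≥0∞} (hf : Measurable f) :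
    Measurable (chainDensity f) := by
  have h1 : Measurable fun x => ∫⁻ y, f (x, y) := hf.lintegral_prod_right'
  have h2 : Measurable fun y => ∫⁻ x, f (x, y) := hf.lintegral_prod_left'
  unfold chainDensity
  exact (((hf.comp (by fun_prop)).div (h2.comp (by fun_prop))).mul (hf.comp (by fun_prop))).mul
    ((hf.comp (by fun_prop)).div (h1.comp (by fun_prop)))

theorem lintegral_prod_reorder {ψ : (ℝ × ℝ) × (ℝ × ℝ) → ℝ≥0∞} (hψ : Measurable ψ) :
    ∫⁻ t : ((ℝ × ℝ) × ℝ) × ℝ, ψ ((t.1.1.1, t.2), (t.1.2, t.1.1.2)) = ∫⁻ w, ψ w := by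
  rw [Measure.volume_eq_prod, lintegral_prod _ (by fun_prop), Measure.volume_eq_prod (ℝ × ℝ) ℝ,
    lintegral_prod, Measure.volume_eq_prod ℝ ℝ, lintegral_prod]
  rotate_left
  · exact (Measurable.lintegral_prod_right'
      (f := fun y : (ℝ × ℝ) × ℝ => ∫⁻ v, ψ ((y.1.1, v), (y.2, y.1.2)))
      (Measurable.lintegral_prod_right'
        (f := fun z : ((ℝ × ℝ) × ℝ) × ℝ => ψ ((z.1.1.1, z.2), (z.1.2, z.1.1.2)))
        (by fun_prop))).aemeasurable
  · exact (Measurable.lintegral_prod_right'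
        (f := fun z : ((ℝ × ℝ) × ℝ) × ℝ => ψ ((z.1.1.1, z.2), (z.1.2, z.1.1.2)))
        (by fun_prop)).aemeasurable
  rw [Measure.volume_eq_prod (ℝ × ℝ) (ℝ × ℝ), lintegral_prod _ hψ.aemeasurable,
    Measure.volume_eq_prod ℝ ℝ, lintegral_prod _ hψ.lintegral_prod_right'.aemeasurable]
  refine lintegral_congr fun u => ?_
  calc ∫⁻ y, ∫⁻ x, ∫⁻ v, ψ ((u, v), (x, y))
      = ∫⁻ y, ∫⁻ v, ∫⁻ x, ψ ((u, v), (x, y)) := by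
        refine lintegral_congr fun y => lintegral_lintegral_swap ?_
        exact Measurable.aemeasurable (by fun_prop)
    _ = ∫⁻ v, ∫⁻ y, ∫⁻ x, ψ ((u, v), (x, y)) := by
        refine lintegral_lintegral_swap ?_
        exact (Measurable.lintegral_prod_right'
          (f := fun z : (ℝ × ℝ) × ℝ => ψ ((u, z.1.2), (z.2, z.1.1))) (by fun_prop)).aemeasurable
    _ = ∫⁻ v, ∫⁻ b : ℝ × ℝ, ψ ((u, v), b) := by
        refine lintegral_congr fun v => ?_
        rw [Measure.volume_eq_prod, lintegral_prod_symm _ (by fun_prop)]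

/-- The chain is a Markov triple `X₂, Y₁, X₁` continued by the Markov triple `(X₂, Y₁), X₁, Y'`. -/
theorem hasDensity_chain {Ω : Type*} [MeasurableSpace Ω] {P : Measure Ω} [IsProbabilityMeasure P]
    {X₂ Y₁ X₁ Y' : Ω → ℝ} {f : ℝ × ℝ → ℝ≥0∞} (hchain : IsMarkovChain X₂ Y₁ X₁ Y' P)
    (h₂ : HasDensity (fun ω => (X₂ ω, Y₁ ω)) P f) (h₁ : HasDensity (fun ω => (X₁ ω, Y₁ ω)) P f)
    (h₃ : HasDensity (fun ω => (X₁ ω, Y' ω)) P f) :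
    HasDensity (fun ω => ((X₂ ω, Y' ω), (X₁ ω, Y₁ ω))) P (chainDensity f) := by
  have hT := (h₂.of_isMarkovTriple h₁.swap hchain.1).of_isMarkovTriple h₃ hchain.2
  have hm := measurable_chainDensity h₂.measurable
  refine HasDensity.of_lintegral ?_ hm fun φ hφ => ?_
  · exact (show Measurable fun t : ((ℝ × ℝ) × ℝ) × ℝ => ((t.1.1.1, t.2), (t.1.2, t.1.1.2)) by
      fun_prop).comp_aemeasurable hT.aemeasurable
  rw [hT.lintegral_comp (φ := fun t => φ ((t.1.1.1, t.2), (t.1.2, t.1.1.2))) (by fun_prop),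
    ← lintegral_prod_reorder (by fun_prop)]
  refine lintegral_congr fun t => ?_
  simp only [chainDensity, div_eq_mul_inv]
  ring

/-! ### Conditionally independent copies -/

/-- A law with density `g` on `E × F` extends to a law of `(U, V, V')` in which `V'` is a copy of `V`
that is conditionally independent of it given `U`. -/
theorem exists_condIndep_copy {E F : Type*} [MeasureSpace E] [MeasureSpace F]
    [SFinite (volume : Measure E)] [SFinite (volume : Measure F)] {g : E × F → ℝ≥0∞}
    (hg : Measurable g) (hg1 : ∫⁻ w, g w = 1) :
    ∃ M : Measure (E × (F × F)), IsProbabilityMeasure M ∧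
      HasDensity (fun x => x) M
        (fun x => g (x.1, x.2.1) * (g (x.1, x.2.2) / ∫⁻ v, g (x.1, v))) ∧
      HasDensity (fun x => (x.1, x.2.1)) M g ∧ HasDensity (fun x => (x.1, x.2.2)) M g := by
  have hm : Measurable fun u => ∫⁻ v, g (u, v) := hg.lintegral_prod_right'
  have hG : Measurable fun x : E × (F × F) =>
      g (x.1, x.2.1) * (g (x.1, x.2.2) / ∫⁻ v, g (x.1, v)) :=
    (hg.comp (by fun_prop)).mul ((hg.comp (by fun_prop)).div (hm.comp measurable_fst))
  have hfin : ∀ᵐ u, ∫⁻ v, g (u, v) < ∞ := by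
    refine ae_lt_top hm ?_
    rw [← lintegral_prod _ hg.aemeasurable, ← Measure.volume_eq_prod, hg1]
    simp
  have hid : HasDensity (fun x => x) (volume.withDensity fun x : E × (F × F) =>
      g (x.1, x.2.1) * (g (x.1, x.2.2) / ∫⁻ v, g (x.1, v))) _ :=
    ⟨aemeasurable_id', hG, Measure.map_id'⟩
  have key (u : E) (hu : ∫⁻ v, g (u, v) < ∞) {φ : F → ℝ≥0∞} (hφ : Measurable φ) :
      ∫⁻ v, ∫⁻ v', φ v * (g (u, v) * (g (u, v') / ∫⁻ v, g (u, v))) = ∫⁻ v, φ v * g (u, v) := by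
    have hgu : Measurable fun v => g (u, v) := by fun_prop
    calc ∫⁻ v, ∫⁻ v', φ v * (g (u, v) * (g (u, v') / ∫⁻ v, g (u, v)))
        = ∫⁻ v, (∫⁻ v', g (u, v')) * (φ v * (g (u, v) / ∫⁻ v, g (u, v))) := by
          refine lintegral_congr fun v => ?_
          rw [← lintegral_mul_const _ hgu]
          refine lintegral_congr fun v' => ?_
          simp only [div_eq_mul_inv]
          ring
      _ = (∫⁻ v', g (u, v')) * ∫⁻ v, φ v * (g (u, v) / ∫⁻ v, g (u, v)) :=
          lintegral_const_mul _ (by fun_prop)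
      _ = _ := ENNReal.mass_mul_lintegral_div hgu hφ hu.ne
  have h1 : HasDensity (fun x => (x.1, x.2.1)) (volume.withDensity fun x : E × (F × F) =>
      g (x.1, x.2.1) * (g (x.1, x.2.2) / ∫⁻ v, g (x.1, v))) g := by
    refine .of_lintegral (by fun_prop) hg fun φ hφ => ?_
    rw [hid.lintegral_comp (φ := fun x => φ (x.1, x.2.1)) (by fun_prop), Measure.volume_eq_prod,
      lintegral_prod _ (by fun_prop), Measure.volume_eq_prod E F, lintegral_prod _ (by fun_prop)]
    refine lintegral_congr_ae ?_
    filter_upwards [hfin] with u hu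
    rw [Measure.volume_eq_prod, lintegral_prod _ (by fun_prop)]
    exact key u hu (φ := fun v => φ (u, v)) (by fun_prop)
  have h2 : HasDensity (fun x => (x.1, x.2.2)) (volume.withDensity fun x : E × (F × F) =>
      g (x.1, x.2.1) * (g (x.1, x.2.2) / ∫⁻ v, g (x.1, v))) g := by
    refine .of_lintegral (by fun_prop) hg fun φ hφ => ?_
    rw [hid.lintegral_comp (φ := fun x => φ (x.1, x.2.2)) (by fun_prop), Measure.volume_eq_prod,
      lintegral_prod _ (by fun_prop), Measure.volume_eq_prod E F, lintegral_prod _ (by fun_prop)]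
    refine lintegral_congr_ae ?_
    filter_upwards [hfin] with u hu
    rw [Measure.volume_eq_prod, lintegral_prod_symm _ (by fun_prop)]
    rw [← key u hu (φ := fun v => φ (u, v)) (by fun_prop)]
    refine lintegral_congr fun v => lintegral_congr fun v' => ?_
    simp only [div_eq_mul_inv]
    ring
  refine ⟨_, ⟨?_⟩, hid, h1, h2⟩
  simpa [hg1] using h1.lintegral_comp (φ := fun _ => 1) measurable_const

/-! ### Weights of expectation at most one -/

/-- Jensen's inequality `E[log R] ≤ log E[R]` in the form `log R ≤ R - 1`. -/
theorem integral_toReal_sub_one_nonpos {Ω : Type*} [MeasurableSpace Ω] {P : Measure Ω}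
    [IsProbabilityMeasure P] {R : Ω → ℝ≥0∞} (hR : AEMeasurable R P) (h1 : ∫⁻ ω, R ω ∂P ≤ 1) :
    Integrable (fun ω => (R ω).toReal - 1) P ∧ ∫ ω, ((R ω).toReal - 1) ∂P ≤ 0 := by
  have hne : ∫⁻ ω, R ω ∂P ≠ ∞ := (h1.trans_lt ENNReal.one_lt_top).ne
  have hi : Integrable (fun ω => (R ω).toReal) P := integrable_toReal_of_lintegral_ne_top hR hne
  refine ⟨hi.sub (integrable_const 1), ?_⟩
  rw [integral_sub hi (integrable_const 1), integral_toReal hR (ae_lt_top' hR hne)]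
  have : (∫⁻ ω, R ω ∂P).toReal ≤ 1 := by simpa using ENNReal.toReal_mono ENNReal.one_ne_top h1
  simpa using this

section Bounds

variable {f : ℝ × ℝ → ℝ≥0∞}

/-- The joint density of `(X₂ + Y', (X₁, Y₁))` in the Markov chain `X₂, Y₁, X₁, Y'`. -/
noncomputable def sumDensity (f : ℝ × ℝ → ℝ≥0∞) (x : ℝ × (ℝ × ℝ)) : ℝ≥0∞ :=
  ∫⁻ u, chainDensity f ((u, x.1 - u), x.2)

theorem measurable_sumDensity (hf : Measurable f) : Measurable (sumDensity f) := by
  have := measurable_chainDensity hf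
  exact Measurable.lintegral_prod_right'
    (f := fun y : (ℝ × (ℝ × ℝ)) × ℝ => chainDensity f ((y.2, y.1.1 - y.2), y.1.2)) (by fun_prop)

/-- With weight `R = f(X₂ + Y' | X₁, Y₁) / f(Y' | X₁)`, this is the bound `E[R] ≤ 1` behind
`h(X₂ + Y' | X₁, Y₁) ≥ h(Y' | X₁)`. -/
theorem lintegral_condSum_div_le_one (hf : Measurable f)
    (h1 : ∫⁻ x, sumDensity f x ≤ 1) :
    ∫⁻ w : (ℝ × ℝ) × (ℝ × ℝ), sumDensity f (w.1.1 + w.1.2, w.2) / f w.2 *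
      (f (w.2.1, w.1.2) / ∫⁻ y, f (w.2.1, y))⁻¹ * chainDensity f w ≤ 1 := by
  have hs := measurable_sumDensity hf
  have hk' (b : ℝ × ℝ) : Measurable fun u => f (u, b.2) / (∫⁻ x, f (x, b.2)) := by fun_prop
  calc _ ≤ ∫⁻ w : (ℝ × ℝ) × (ℝ × ℝ),
        f (w.1.1, w.2.2) / (∫⁻ x, f (x, w.2.2)) * sumDensity f (w.1.1 + w.1.2, w.2) := by
        refine lintegral_mono fun w => ?_
        simp only [chainDensity]
        generalize f (w.1.1, w.2.2) / (∫⁻ x, f (x, w.2.2)) = a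
        generalize f (w.2.1, w.1.2) / (∫⁻ y, f (w.2.1, y)) = c
        generalize f w.2 = b
        calc _ = a * sumDensity f (w.1.1 + w.1.2, w.2) * (b * b⁻¹) * (c * c⁻¹) := by
              rw [div_eq_mul_inv]; ring
          _ ≤ a * sumDensity f (w.1.1 + w.1.2, w.2) * 1 * 1 := by
              gcongr <;> exact ENNReal.mul_inv_le_one _
          _ = _ := by simp
    _ = ∫⁻ b : ℝ × ℝ, (∫⁻ u, f (u, b.2) / (∫⁻ x, f (x, b.2))) * ∫⁻ z, sumDensity f (z, b) := by
        rw [Measure.volume_eq_prod, lintegral_prod_symm _ (Measurable.aemeasurable (by fun_prop))]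
        refine lintegral_congr fun b => ?_
        rw [Measure.volume_eq_prod, lintegral_prod _ (by fun_prop), ← lintegral_mul_const _ (hk' b)]
        refine lintegral_congr fun u => ?_
        dsimp only
        rw [lintegral_const_mul _ (by fun_prop)]
        congr 1
        exact lintegral_add_left_eq_self (fun z => sumDensity f (z, b)) u
    _ ≤ ∫⁻ b : ℝ × ℝ, 1 * ∫⁻ z, sumDensity f (z, b) := by
        gcongr with b
        exact ENNReal.lintegral_div_self_le_one (by fun_prop)
    _ = ∫⁻ x, sumDensity f x := by
        simp_rw [one_mul]
        rw [Measure.volume_eq_prod ℝ (ℝ × ℝ), lintegral_prod_symm _ (by fun_prop)]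
    _ ≤ 1 := h1

/-- With weight `R = p(X₂) q(Y') / m(X₂, Y')`, where `m` is the density of `(X₂, Y')`, this is the
bound `E[R] ≤ 1` behind `h(X₂, Y') ≤ h(X₂) + h(Y')`. -/
theorem lintegral_indep_div_le_one {p q : ℝ → ℝ≥0∞} {g : (ℝ × ℝ) × (ℝ × ℝ) → ℝ≥0∞}
    (hp : Measurable p) (hq : Measurable q) (hg : Measurable g)
    (hp1 : ∫⁻ x, p x = 1) (hq1 : ∫⁻ y, q y = 1) :
    ∫⁻ w : (ℝ × ℝ) × (ℝ × ℝ), p w.1.1 * q w.1.2 / (∫⁻ b, g (w.1, b)) * g w ≤ 1 := by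
  calc _ = ∫⁻ a : ℝ × ℝ, p a.1 * q a.2 / (∫⁻ b, g (a, b)) * ∫⁻ b, g (a, b) := by
        rw [Measure.volume_eq_prod, lintegral_prod _ (Measurable.aemeasurable (by fun_prop))]
        refine lintegral_congr fun a => ?_
        dsimp only
        rw [lintegral_const_mul _ (by fun_prop)]
    _ ≤ ∫⁻ a : ℝ × ℝ, p a.1 * q a.2 := by
        refine lintegral_mono fun a => ?_
        rw [mul_comm]
        exact ENNReal.mul_div_le
    _ = 1 := by
        rw [Measure.volume_eq_prod, lintegral_prod_mul hp.aemeasurable hq.aemeasurable, hp1, hq1,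
          one_mul]

/-- In the integral over `(s, t)` of the three sum densities, substitute `a = x + s` and
`c = t + y`; the middle argument becomes `a + c - (x + y)`, and the result depends on `x + y` only. -/
theorem lintegral_three_sums {S : ℝ → ℝ≥0∞} (hS : Measurable S) (x y : ℝ) :
    ∫⁻ b : ℝ × ℝ, S (x + b.2) * S (b.1 + b.2) * S (b.1 + y) =
      ∫⁻ c, ∫⁻ a, S a * S (a + c - (x + y)) * S c := by
  rw [Measure.volume_eq_prod, lintegral_prod _ (by fun_prop)]
  calc ∫⁻ t, ∫⁻ s, S (x + s) * S (t + s) * S (t + y)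
      = ∫⁻ t, ∫⁻ a, S a * S (a + (t + y) - (x + y)) * S (t + y) := by
        refine lintegral_congr fun t => ?_
        rw [← lintegral_add_left_eq_self (fun a => S a * S (a + (t + y) - (x + y)) * S (t + y)) x]
        refine lintegral_congr fun s => ?_
        congr 3
        ring
    _ = _ := lintegral_add_right_eq_self
        (fun c => ∫⁻ a, S a * S (a + c - (x + y)) * S c) y

theorem lintegral_lintegral_three_sums {S : ℝ → ℝ≥0∞} (hS : Measurable S) (hS1 : ∫⁻ z, S z = 1) :
    ∫⁻ z, ∫⁻ c, ∫⁻ a, S a * S (a + c - z) * S c = 1 := by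
  calc ∫⁻ z, ∫⁻ c, ∫⁻ a, S a * S (a + c - z) * S c
      = ∫⁻ c, ∫⁻ z, ∫⁻ a, S a * S (a + c - z) * S c := by
        refine lintegral_lintegral_swap (Measurable.aemeasurable ?_)
        exact Measurable.lintegral_prod_right'
          (f := fun y : (ℝ × ℝ) × ℝ => S y.2 * S (y.2 + y.1.2 - y.1.1) * S y.1.2) (by fun_prop)
    _ = ∫⁻ c, ∫⁻ a, ∫⁻ z, S a * S (a + c - z) * S c := by
        refine lintegral_congr fun c => lintegral_lintegral_swap (Measurable.aemeasurable ?_)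
        fun_prop
    _ = ∫⁻ c, ∫⁻ a, S a * S c := by
        refine lintegral_congr fun c => lintegral_congr fun a => ?_
        rw [lintegral_mul_const _ (by fun_prop), lintegral_const_mul _ (by fun_prop),
          lintegral_sub_left_eq_self S (a + c), hS1, mul_one]
    _ = 1 := by
        simp_rw [lintegral_mul_const _ hS, hS1, one_mul, hS1]

/-- Let `(T, S)` be a conditionally independent copy of `(X₁, Y₁)` given `(X₂, Y')`. The map
`(x₁, y₁, x₂, y', t, s) ↦ (x₁, y₁, x₂, x₂ + s, t + s, t + y')` preserves volume and
`x₂ + y' = (x₂ + s) - (t + s) + (t + y')`; integrating out `x₂` cancels the density of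
`(X₂ + Y', X₁, Y₁)`. This bounds by one the expectation of the weight behind
`h(X₂ + Y', X₁, Y₁) + h(X₂, Y', X₁, Y₁, T, S) ≤
  h(X₁, Y₁) + h(X₂ + S) + h(T + S) + h(T + Y') + h(X₂, Y', X₁, Y₁)`. -/
theorem lintegral_copy_weight_le_one {S : ℝ → ℝ≥0∞} (hf : Measurable f) (hf1 : ∫⁻ x, f x = 1)
    (hS : Measurable S) (hS1 : ∫⁻ z, S z = 1) :
    ∫⁻ x : (ℝ × ℝ) × ((ℝ × ℝ) × (ℝ × ℝ)), (sumDensity f (x.1.1 + x.1.2, x.2.1) / f x.2.1)⁻¹ *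
      (S (x.1.1 + x.2.2.2) * S (x.2.2.1 + x.2.2.2) * S (x.2.2.1 + x.1.2)) *
      (chainDensity f (x.1, x.2.2) / ∫⁻ b, chainDensity f (x.1, b))⁻¹ *
      (chainDensity f (x.1, x.2.1) *
        (chainDensity f (x.1, x.2.2) / ∫⁻ b, chainDensity f (x.1, b))) ≤ 1 := by
  have hs := measurable_sumDensity hf
  have hg := measurable_chainDensity hf
  set J : ℝ → ℝ≥0∞ := fun z => ∫⁻ c, ∫⁻ a, S a * S (a + c - z) * S c with hJ
  have hJm : Measurable J :=
    Measurable.lintegral_prod_right'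
      (f := fun x : ℝ × ℝ => ∫⁻ a, S a * S (a + x.2 - x.1) * S x.2)
      (Measurable.lintegral_prod_right'
        (f := fun y : (ℝ × ℝ) × ℝ => S y.2 * S (y.2 + y.1.2 - y.1.1) * S y.1.2) (by fun_prop))
  calc _ ≤ ∫⁻ x : (ℝ × ℝ) × ((ℝ × ℝ) × (ℝ × ℝ)),
        (sumDensity f (x.1.1 + x.1.2, x.2.1) / f x.2.1)⁻¹ * chainDensity f (x.1, x.2.1) *
          (S (x.1.1 + x.2.2.2) * S (x.2.2.1 + x.2.2.2) * S (x.2.2.1 + x.1.2)) := by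
        refine lintegral_mono fun x => ?_
        simp only
        generalize chainDensity f (x.1, x.2.2) / ∫⁻ b, chainDensity f (x.1, b) = k
        generalize S (x.1.1 + x.2.2.2) * S (x.2.2.1 + x.2.2.2) * S (x.2.2.1 + x.1.2) = σ
        generalize (sumDensity f (x.1.1 + x.1.2, x.2.1) / f x.2.1)⁻¹ = r
        calc _ = r * chainDensity f (x.1, x.2.1) * σ * (k * k⁻¹) := by ring
          _ ≤ r * chainDensity f (x.1, x.2.1) * σ * 1 := by
              gcongr
              exact ENNReal.mul_inv_le_one _
          _ = _ := by simp
    _ = ∫⁻ w : (ℝ × ℝ) × (ℝ × ℝ), (sumDensity f (w.1.1 + w.1.2, w.2) / f w.2)⁻¹ *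
          chainDensity f w * J (w.1.1 + w.1.2) := by
        rw [Measure.volume_eq_prod (ℝ × ℝ) ((ℝ × ℝ) × (ℝ × ℝ)), lintegral_prod _ (by fun_prop),
          Measure.volume_eq_prod (ℝ × ℝ) (ℝ × ℝ), lintegral_prod _ (by fun_prop)]
        refine lintegral_congr fun a => ?_
        rw [lintegral_prod _ (by fun_prop)]
        refine lintegral_congr fun b => ?_
        dsimp only
        rw [lintegral_const_mul _ (by fun_prop), lintegral_three_sums hS]
    _ = ∫⁻ b : ℝ × ℝ, ∫⁻ z, (sumDensity f (z, b) / f b)⁻¹ * sumDensity f (z, b) * J z := by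
        rw [Measure.volume_eq_prod, lintegral_prod_symm _ (by fun_prop)]
        refine lintegral_congr fun b => ?_
        rw [Measure.volume_eq_prod, lintegral_prod _ (by fun_prop)]
        calc ∫⁻ u, ∫⁻ v, (sumDensity f (u + v, b) / f b)⁻¹ * chainDensity f ((u, v), b) *
              J (u + v)
            = ∫⁻ u, ∫⁻ z, (sumDensity f (z, b) / f b)⁻¹ * J z *
                chainDensity f ((u, z - u), b) := by
              refine lintegral_congr fun u => ?_
              rw [← lintegral_add_left_eq_self (fun z => (sumDensity f (z, b) / f b)⁻¹ * J z *
                chainDensity f ((u, z - u), b)) u]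
              refine lintegral_congr fun v => ?_
              rw [add_sub_cancel_left]
              ring
          _ = ∫⁻ z, ∫⁻ u, (sumDensity f (z, b) / f b)⁻¹ * J z *
                chainDensity f ((u, z - u), b) :=
              lintegral_lintegral_swap (Measurable.aemeasurable (by fun_prop))
          _ = _ := by
              refine lintegral_congr fun z => ?_
              rw [lintegral_const_mul _ (by fun_prop), sumDensity]
              ring
    _ ≤ ∫⁻ b : ℝ × ℝ, ∫⁻ z, f b * J z := by
        refine lintegral_mono_ae ?_
        filter_upwards [ae_lt_top hf (by rw [hf1]; simp)] with b hb
        refine lintegral_mono fun z => ?_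
        gcongr
        -- With `0 / 0 = 0` and `0⁻¹ = ∞`, the case of a vanishing density needs separate care.
        rcases eq_or_ne (sumDensity f (z, b)) 0 with h0 | h0
        · simp [h0]
        · rw [mul_comm, ENNReal.inv_div (.inl hb.ne) (.inr h0)]
          exact ENNReal.mul_div_le
    _ = 1 := by
        simp_rw [lintegral_const_mul _ hJm, hJ, lintegral_lintegral_three_sums hS hS1, mul_one]
        exact hf1

end Bounds

/-! ### The entropy of the sum along the chain -/

/-- The density `m` of `(X₂, Y')` cancels between the two logarithms, so that no integrability of
`log m` is needed. -/
theorem Real.log_copy_weight {z b s₁ s₂ s₃ f₁ f₂ f₃ p q m p' q' : ℝ} (hz : z ≠ 0) (hb : b ≠ 0)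
    (hs₁ : s₁ ≠ 0) (hs₂ : s₂ ≠ 0) (hs₃ : s₃ ≠ 0) (hf₁ : f₁ ≠ 0) (hf₂ : f₂ ≠ 0) (hf₃ : f₃ ≠ 0)
    (hp : p ≠ 0) (hq : q ≠ 0) (hm : m ≠ 0) (hp' : p' ≠ 0) (hq' : q' ≠ 0) :
    log ((z / b)⁻¹ * (s₁ * s₂ * s₃) * (f₂ / q * f₁ * (f₃ / p) / m)⁻¹) + log (p' * q' / m) =
      -log (z / b) + (log s₁ + log s₂ + log s₃ - (log f₂ - log q + log f₁ + (log f₃ - log p))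
        + log p' + log q') := by
  have hzb : z / b ≠ 0 := div_ne_zero hz hb
  have h₂ : f₂ / q ≠ 0 := div_ne_zero hf₂ hq
  have h₃ : f₃ / p ≠ 0 := div_ne_zero hf₃ hp
  have hk : f₂ / q * f₁ * (f₃ / p) ≠ 0 := mul_ne_zero (mul_ne_zero h₂ hf₁) h₃
  rw [log_mul (mul_ne_zero (inv_ne_zero hzb) (mul_ne_zero (mul_ne_zero hs₁ hs₂) hs₃))
      (inv_ne_zero (div_ne_zero hk hm)), log_mul (inv_ne_zero hzb)
      (mul_ne_zero (mul_ne_zero hs₁ hs₂) hs₃), log_inv, log_inv,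
    log_mul (mul_ne_zero hs₁ hs₂) hs₃, log_mul hs₁ hs₂, log_div hk hm,
    log_mul (mul_ne_zero h₂ hf₁) h₃, log_mul h₂ hf₁, log_div hf₂ hq, log_div hf₃ hp,
    log_div (mul_ne_zero hp' hq') hm, log_mul hp' hq']
  ring

theorem integral_add_of_eq {Ω : Type*} [MeasurableSpace Ω] {P : Measure Ω} {u v : Ω → ℝ} {a b : ℝ}
    (hu : Integrable u P ∧ ∫ ω, u ω ∂P = a) (hv : Integrable v P ∧ ∫ ω, v ω ∂P = b) :
    Integrable (fun ω => u ω + v ω) P ∧ ∫ ω, (u ω + v ω) ∂P = a + b :=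
  ⟨hu.1.add hv.1, by rw [integral_add hu.1 hv.1, hu.2, hv.2]⟩

theorem integral_sub_of_eq {Ω : Type*} [MeasurableSpace Ω] {P : Measure Ω} {u v : Ω → ℝ} {a b : ℝ}
    (hu : Integrable u P ∧ ∫ ω, u ω ∂P = a) (hv : Integrable v P ∧ ∫ ω, v ω ∂P = b) :
    Integrable (fun ω => u ω - v ω) P ∧ ∫ ω, (u ω - v ω) ∂P = a - b :=
  ⟨hu.1.sub hv.1, by rw [integral_sub hu.1 hv.1, hu.2, hv.2]⟩

/-- The entropy of the sum in a Markov chain `X₂, Y₁, X₁, Y'`: the conditional entropy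
`h(X₂ + Y' | X₁, Y₁)` is finite and at most `3 h(X + Y) + 2 h(X) + 2 h(Y) - 3 h(X, Y)`. It is bounded
below by `h(Y' | X₁)` through the first weight; the upper bound combines submodularity, applied to a
conditionally independent copy of `(X₁, Y₁)` given `(X₂, Y')`, with `h(X₂, Y') ≤ h(X₂) + h(Y')`. -/
theorem integral_log_condSum {Ω : Type*} [MeasurableSpace Ω] {P : Measure Ω}
    [IsProbabilityMeasure P] {X₂ Y₁ X₁ Y' : Ω → ℝ} {f : ℝ × ℝ → ℝ≥0∞} {S : ℝ → ℝ≥0∞}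
    {cf cp cq cs : ℝ}
    (h₂ : HasDensity (fun ω => (X₂ ω, Y₁ ω)) P f) (h₁ : HasDensity (fun ω => (X₁ ω, Y₁ ω)) P f)
    (h₃ : HasDensity (fun ω => (X₁ ω, Y' ω)) P f)
    (hW : HasDensity (fun ω => ((X₂ ω, Y' ω), (X₁ ω, Y₁ ω))) P (chainDensity f))
    (hS : HasDensity (fun ω => X₁ ω + Y₁ ω) P S)
    (hif : Integrable (fun ω => Real.log (f (X₁ ω, Y₁ ω)).toReal) P ∧
      ∫ ω, Real.log (f (X₁ ω, Y₁ ω)).toReal ∂P = cf)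
    (hip : Integrable (fun ω => Real.log (∫⁻ y, f (X₁ ω, y)).toReal) P ∧
      ∫ ω, Real.log (∫⁻ y, f (X₁ ω, y)).toReal ∂P = cp)
    (hiq : Integrable (fun ω => Real.log (∫⁻ x, f (x, Y₁ ω)).toReal) P ∧
      ∫ ω, Real.log (∫⁻ x, f (x, Y₁ ω)).toReal ∂P = cq)
    (his : Integrable (fun ω => Real.log (S (X₁ ω + Y₁ ω)).toReal) P ∧
      ∫ ω, Real.log (S (X₁ ω + Y₁ ω)).toReal ∂P = cs) :
    Integrable (fun ω => Real.log
        (sumDensity f (X₂ ω + Y' ω, (X₁ ω, Y₁ ω)) / f (X₁ ω, Y₁ ω)).toReal) P ∧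
      -∫ ω, Real.log (sumDensity f (X₂ ω + Y' ω, (X₁ ω, Y₁ ω)) / f (X₁ ω, Y₁ ω)).toReal ∂P ≤
        3 * cf - 2 * cp - 2 * cq - 3 * cs := by
  have hf := h₁.measurable
  have hg := hW.measurable
  have hsm := measurable_sumDensity hf
  have hpm : Measurable fun x => ∫⁻ y, f (x, y) := h₁.fst.measurable
  have hqm : Measurable fun y => ∫⁻ x, f (x, y) := h₁.snd.measurable
  have hSm := hS.measurable
  have hZ : HasDensity (fun ω => (X₂ ω + Y' ω, (X₁ ω, Y₁ ω))) P (sumDensity f) :=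
    hW.shear.snd_prodMk
  obtain ⟨M, hM, hid, hA, hC⟩ := exists_condIndep_copy hg hW.lintegral_eq_one
  -- A point of the extended space is `((x₂, y'), (x₁, y₁), (t, s))`.
  have kB : HasDensity (fun x : (ℝ × ℝ) × ((ℝ × ℝ) × (ℝ × ℝ)) => x.2.1) M f :=
    hA.comp_transfer hW (φ := fun w => w.2) (by fun_prop) h₁
  have kZ : HasDensity (fun x : (ℝ × ℝ) × ((ℝ × ℝ) × (ℝ × ℝ)) => (x.1.1 + x.1.2, x.2.1)) M
      (sumDensity f) :=
    hA.comp_transfer hW (φ := fun w => (w.1.1 + w.1.2, w.2)) (by fun_prop) hZ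
  have kY : HasDensity (fun x : (ℝ × ℝ) × ((ℝ × ℝ) × (ℝ × ℝ)) => (x.2.1.1, x.1.2)) M f :=
    hA.comp_transfer hW (φ := fun w => (w.2.1, w.1.2)) (by fun_prop) h₃
  have k₂ : HasDensity (fun x : (ℝ × ℝ) × ((ℝ × ℝ) × (ℝ × ℝ)) => (x.1.1, x.2.2.2)) M f :=
    hC.comp_transfer hW (φ := fun w => (w.1.1, w.2.2)) (by fun_prop) h₂
  have k₁ : HasDensity (fun x : (ℝ × ℝ) × ((ℝ × ℝ) × (ℝ × ℝ)) => (x.2.2.1, x.2.2.2)) M f :=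
    hC.comp_transfer hW (φ := fun w => (w.2.1, w.2.2)) (by fun_prop) h₁
  have k₃ : HasDensity (fun x : (ℝ × ℝ) × ((ℝ × ℝ) × (ℝ × ℝ)) => (x.2.2.1, x.1.2)) M f :=
    hC.comp_transfer hW (φ := fun w => (w.2.1, w.1.2)) (by fun_prop) h₃
  have km := hC.fst
  have s₂ := k₂.comp_transfer h₁ (φ := fun v => v.1 + v.2) (by fun_prop) hS
  have s₁ := k₁.comp_transfer h₁ (φ := fun v => v.1 + v.2) (by fun_prop) hS
  have s₃ := k₃.comp_transfer h₁ (φ := fun v => v.1 + v.2) (by fun_prop) hS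
  have ifY := kY.integral_log_transfer h₁ hif
  have ipY := kY.fst.integral_log_transfer h₁.fst hip
  have if₂ := k₂.integral_log_transfer h₁ hif
  have if₁ := k₁.integral_log_transfer h₁ hif
  have if₃ := k₃.integral_log_transfer h₁ hif
  have is₂ := s₂.integral_log_transfer hS his
  have is₁ := s₁.integral_log_transfer hS his
  have is₃ := s₃.integral_log_transfer hS his
  have ip₂ := k₂.fst.integral_log_transfer h₁.fst hip
  have ip₁ := k₁.fst.integral_log_transfer h₁.fst hip
  have iq₂ := k₂.snd.integral_log_transfer h₁.snd hiq
  have iq₃ := k₃.snd.integral_log_transfer h₁.snd hiq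
  dsimp only at s₁ s₂ s₃ is₁ is₂ is₃
  -- The three weights and their expectations.
  have e₁ := (hA.lintegral_comp (φ := fun w => sumDensity f (w.1.1 + w.1.2, w.2) / f w.2 *
      (f (w.2.1, w.1.2) / ∫⁻ y, f (w.2.1, y))⁻¹) (by fun_prop)).trans_le
    (lintegral_condSum_div_le_one hf hZ.lintegral_eq_one.le)
  have e₂ := (hid.lintegral_comp (φ := fun x =>
      (sumDensity f (x.1.1 + x.1.2, x.2.1) / f x.2.1)⁻¹ *
      (S (x.1.1 + x.2.2.2) * S (x.2.2.1 + x.2.2.2) * S (x.2.2.1 + x.1.2)) *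
      (chainDensity f (x.1, x.2.2) / ∫⁻ b, chainDensity f (x.1, b))⁻¹) (by fun_prop)).trans_le
    (lintegral_copy_weight_le_one hf h₁.lintegral_eq_one hSm hS.lintegral_eq_one)
  have e₃ := (hA.lintegral_comp (φ := fun w => (∫⁻ y, f (w.1.1, y)) * (∫⁻ x, f (x, w.1.2)) /
      ∫⁻ b, chainDensity f (w.1, b)) (by fun_prop)).trans_le
    (lintegral_indep_div_le_one hpm hqm hg h₁.fst.lintegral_eq_one h₁.snd.lintegral_eq_one)
  dsimp only at e₁ e₂ e₃
  obtain ⟨j₁, -⟩ := integral_toReal_sub_one_nonpos (by fun_prop) e₁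
  obtain ⟨j₂, l₂⟩ := integral_toReal_sub_one_nonpos (by fun_prop) e₂
  obtain ⟨j₃, l₃⟩ := integral_toReal_sub_one_nonpos (by fun_prop) e₃
  have hid' : IdentDistrib (fun x : (ℝ × ℝ) × ((ℝ × ℝ) × (ℝ × ℝ)) =>
        Real.log (sumDensity f (x.1.1 + x.1.2, x.2.1) / f x.2.1).toReal)
      (fun ω => Real.log (sumDensity f (X₂ ω + Y' ω, (X₁ ω, Y₁ ω)) / f (X₁ ω, Y₁ ω)).toReal) M P :=
    (kZ.identDistrib hZ).comp (u := fun v => Real.log (sumDensity f v / f v.2).toReal)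
      (by fun_prop)
  rw [← hid'.integrable_iff, ← hid'.integral_eq]
  -- `b` is what remains of the logarithms of the last two weights besides the wanted one.
  set b : (ℝ × ℝ) × ((ℝ × ℝ) × (ℝ × ℝ)) → ℝ := fun x =>
    Real.log (S (x.1.1 + x.2.2.2)).toReal + Real.log (S (x.2.2.1 + x.2.2.2)).toReal +
      Real.log (S (x.2.2.1 + x.1.2)).toReal -
      (Real.log (f (x.1.1, x.2.2.2)).toReal - Real.log (∫⁻ u, f (u, x.2.2.2)).toReal +
        Real.log (f (x.2.2.1, x.2.2.2)).toReal +
        (Real.log (f (x.2.2.1, x.1.2)).toReal - Real.log (∫⁻ v, f (x.2.2.1, v)).toReal)) +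
      Real.log (∫⁻ v, f (x.1.1, v)).toReal + Real.log (∫⁻ u, f (u, x.1.2)).toReal with hb
  obtain ⟨hbi, hbc⟩ : Integrable b M ∧ ∫ x, b x ∂M =
      cs + cs + cs - (cf - cq + cf + (cf - cp)) + cp + cq :=
    integral_add_of_eq (integral_add_of_eq (integral_sub_of_eq
      (integral_add_of_eq (integral_add_of_eq is₂ is₁) is₃)
      (integral_add_of_eq (integral_add_of_eq (integral_sub_of_eq if₂ iq₂) if₁)
        (integral_sub_of_eq if₃ ip₁))) ip₂) iq₃
  have hup : ∀ᵐ x ∂M, Real.log (sumDensity f (x.1.1 + x.1.2, x.2.1) / f x.2.1).toReal ≤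
      (sumDensity f (x.1.1 + x.1.2, x.2.1) / f x.2.1 *
        (f (x.2.1.1, x.1.2) / ∫⁻ y, f (x.2.1.1, y))⁻¹).toReal - 1 +
      (Real.log (f (x.2.1.1, x.1.2)).toReal - Real.log (∫⁻ y, f (x.2.1.1, y)).toReal) := by
    filter_upwards [kB.ae_toReal_ne_zero, kZ.ae_toReal_ne_zero, kY.ae_toReal_ne_zero,
      kY.fst.ae_toReal_ne_zero] with x n₁ n₂ n₃ n₄
    have hpos : 0 < (sumDensity f (x.1.1 + x.1.2, x.2.1) / f x.2.1 *
        (f (x.2.1.1, x.1.2) / ∫⁻ y, f (x.2.1.1, y))⁻¹).toReal := by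
      refine lt_of_le_of_ne ENNReal.toReal_nonneg (Ne.symm ?_)
      rw [ENNReal.toReal_mul, ENNReal.toReal_inv, ENNReal.toReal_div, ENNReal.toReal_div]
      exact mul_ne_zero (div_ne_zero n₂ n₁) (inv_ne_zero (div_ne_zero n₃ n₄))
    have hlog := Real.log_le_sub_one_of_pos hpos
    have hexp : Real.log (sumDensity f (x.1.1 + x.1.2, x.2.1) / f x.2.1 *
        (f (x.2.1.1, x.1.2) / ∫⁻ y, f (x.2.1.1, y))⁻¹).toReal =
        Real.log (sumDensity f (x.1.1 + x.1.2, x.2.1) / f x.2.1).toReal -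
        (Real.log (f (x.2.1.1, x.1.2)).toReal - Real.log (∫⁻ y, f (x.2.1.1, y)).toReal) := by
      rw [ENNReal.toReal_mul, ENNReal.toReal_inv, ENNReal.toReal_div, ENNReal.toReal_div,
        Real.log_mul (div_ne_zero n₂ n₁) (inv_ne_zero (div_ne_zero n₃ n₄)), Real.log_inv,
        Real.log_div n₃ n₄]
      ring
    linarith
  have hlo : ∀ᵐ x ∂M, -Real.log (sumDensity f (x.1.1 + x.1.2, x.2.1) / f x.2.1).toReal ≤
      (((sumDensity f (x.1.1 + x.1.2, x.2.1) / f x.2.1)⁻¹ *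
        (S (x.1.1 + x.2.2.2) * S (x.2.2.1 + x.2.2.2) * S (x.2.2.1 + x.1.2)) *
        (chainDensity f (x.1, x.2.2) / ∫⁻ b, chainDensity f (x.1, b))⁻¹).toReal - 1) +
      (((∫⁻ y, f (x.1.1, y)) * (∫⁻ u, f (u, x.1.2)) /
        ∫⁻ b, chainDensity f (x.1, b)).toReal - 1) - b x := by
    filter_upwards [kB.ae_toReal_ne_zero, kZ.ae_toReal_ne_zero, s₁.ae_toReal_ne_zero,
      s₂.ae_toReal_ne_zero, s₃.ae_toReal_ne_zero, k₁.ae_toReal_ne_zero, k₂.ae_toReal_ne_zero,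
      k₃.ae_toReal_ne_zero, k₁.fst.ae_toReal_ne_zero, k₂.snd.ae_toReal_ne_zero,
      km.ae_toReal_ne_zero, k₂.fst.ae_toReal_ne_zero, k₃.snd.ae_toReal_ne_zero]
      with x n₁ n₂ n₃ n₄ n₅ n₆ n₇ n₈ n₉ n₁₀ n₁₁ n₁₂ n₁₃
    have hw := Real.log_copy_weight n₂ n₁ n₄ n₃ n₅ n₆ n₇ n₈ n₉ n₁₀ n₁₁ n₁₂ n₁₃
    have hk : (chainDensity f (x.1, x.2.2)).toReal =
        (f (x.1.1, x.2.2.2)).toReal / (∫⁻ u, f (u, x.2.2.2)).toReal *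
          (f (x.2.2.1, x.2.2.2)).toReal *
          ((f (x.2.2.1, x.1.2)).toReal / (∫⁻ v, f (x.2.2.1, v)).toReal) := by
      simp only [chainDensity, ENNReal.toReal_mul, ENNReal.toReal_div]
    have hR₂ : 0 < ((sumDensity f (x.1.1 + x.1.2, x.2.1) / f x.2.1)⁻¹ *
        (S (x.1.1 + x.2.2.2) * S (x.2.2.1 + x.2.2.2) * S (x.2.2.1 + x.1.2)) *
        (chainDensity f (x.1, x.2.2) / ∫⁻ b, chainDensity f (x.1, b))⁻¹).toReal := by
      refine lt_of_le_of_ne ENNReal.toReal_nonneg (Ne.symm ?_)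
      simp only [ENNReal.toReal_mul, ENNReal.toReal_inv, ENNReal.toReal_div, hk]
      exact mul_ne_zero (mul_ne_zero (inv_ne_zero (div_ne_zero n₂ n₁))
        (mul_ne_zero (mul_ne_zero n₄ n₃) n₅)) (inv_ne_zero (div_ne_zero (mul_ne_zero
          (mul_ne_zero (div_ne_zero n₇ n₁₀) n₆) (div_ne_zero n₈ n₉)) n₁₁))
    have hR₃ : 0 < ((∫⁻ y, f (x.1.1, y)) * (∫⁻ u, f (u, x.1.2)) /
        ∫⁻ b, chainDensity f (x.1, b)).toReal := by
      refine lt_of_le_of_ne ENNReal.toReal_nonneg (Ne.symm ?_)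
      rw [ENNReal.toReal_div, ENNReal.toReal_mul]
      exact div_ne_zero (mul_ne_zero n₁₂ n₁₃) n₁₁
    have hl₂ := Real.log_le_sub_one_of_pos hR₂
    have hl₃ := Real.log_le_sub_one_of_pos hR₃
    rw [← hk] at hw
    have hsum := add_le_add hl₂ hl₃
    simp only [ENNReal.toReal_mul, ENNReal.toReal_inv, ENNReal.toReal_div] at hsum ⊢
    rw [hw] at hsum
    simp only [hb]
    linarith
  have hint : Integrable (fun x : (ℝ × ℝ) × ((ℝ × ℝ) × (ℝ × ℝ)) =>
      Real.log (sumDensity f (x.1.1 + x.1.2, x.2.1) / f x.2.1).toReal) M := by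
    refine integrable_of_le_of_le (Measurable.aestronglyMeasurable (by fun_prop)) ?_ hup
      ((j₂.add j₃).sub hbi).neg (j₁.add (ifY.1.sub ipY.1))
    filter_upwards [hlo] with x hx
    simp only [Pi.neg_apply, Pi.sub_apply, Pi.add_apply]
    linarith
  refine ⟨hint, ?_⟩
  have hfinal := integral_mono_ae hint.neg ((j₂.add j₃).sub hbi) hlo
  have hsplit := integral_sub (j₂.add j₃) hbi
  have hsplit' := integral_add j₂ j₃
  simp only [Pi.add_apply, Pi.neg_apply, Pi.sub_apply, integral_neg] at hfinal hsplit
  linarith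

/-! ### The Balog–Szemerédi–Gowers bounds -/

theorem theorem6
    {Ω Ω' : Type*} [MeasurableSpace Ω] [MeasurableSpace Ω']
    (P : Measure Ω) [IsProbabilityMeasure P] (P' : Measure Ω') [IsProbabilityMeasure P']
    (X Y : Ω → ℝ)
    (hX : HasFiniteDiffEntropy X P) (hY : HasFiniteDiffEntropy Y P)
    (hXY : HasFiniteDiffEntropy (fun ω => (X ω, Y ω)) P)
    (hsum : HasFiniteDiffEntropy (fun ω => X ω + Y ω) P)
    (K : ℝ) (hK : 1 ≤ K)
    (hI : mutualInfo X Y P ≤ Real.log K)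
    (hS : diffEntropy (fun ω => X ω + Y ω) P
      ≤ (1 / 2) * diffEntropy X P + (1 / 2) * diffEntropy Y P + Real.log K)
    -- the Markov chain `X₂, Y₁, X₁, Y'`, where `Y₁` is the copy of `Y` in the chain
    (X₂ Y₁ X₁ Y' : Ω' → ℝ)
    (hchain : IsMarkovChain X₂ Y₁ X₁ Y' P')
    (h₂ : IdentDistrib (fun ω => (X₂ ω, Y₁ ω)) (fun ω => (X ω, Y ω)) P' P)
    (h₁ : IdentDistrib (fun ω => (X₁ ω, Y₁ ω)) (fun ω => (X ω, Y ω)) P' P)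
    (h₃ : IdentDistrib (fun ω => (X₁ ω, Y' ω)) (fun ω => (X ω, Y ω)) P' P) :
    (HasFiniteCondDiffEntropy X₂ (fun ω => (X₁ ω, Y₁ ω)) P' ∧
      diffEntropy X P - Real.log K ≤ condDiffEntropy X₂ (fun ω => (X₁ ω, Y₁ ω)) P') ∧
    (HasFiniteCondDiffEntropy Y' (fun ω => (X₁ ω, Y₁ ω)) P' ∧
      diffEntropy Y P - Real.log K ≤ condDiffEntropy Y' (fun ω => (X₁ ω, Y₁ ω)) P') ∧
    (HasFiniteCondDiffEntropy (fun ω => X₂ ω + Y' ω) (fun ω => (X₁ ω, Y₁ ω)) P' ∧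
      condDiffEntropy (fun ω => X₂ ω + Y' ω) (fun ω => (X₁ ω, Y₁ ω)) P'
        ≤ (1 / 2) * diffEntropy X P + (1 / 2) * diffEntropy Y P + 7 * Real.log K) := by
  obtain ⟨f, hf⟩ : ∃ f, HasDensity (fun ω => (X ω, Y ω)) P f := ⟨_, .of_hasPDF hXY.1⟩
  obtain ⟨S, hSd⟩ : ∃ S, HasDensity (fun ω => X ω + Y ω) P S := ⟨_, .of_hasPDF hsum.1⟩
  have d₂ := hf.of_identDistrib h₂
  have d₁ := hf.of_identDistrib h₁
  have d₃ := hf.of_identDistrib h₃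
  have dS := d₁.comp_transfer hf (φ := fun v => v.1 + v.2) (by fun_prop) hSd
  have hW := hasDensity_chain hchain d₂ d₁ d₃
  have hfm := hf.measurable
  have lf := hf.integral_log hXY
  have lp := hf.fst.integral_log hX
  have lq := hf.snd.integral_log hY
  have ls := hSd.integral_log hsum
  have lf₂ := d₂.integral_log_transfer hf lf
  have lq₂ := d₂.snd.integral_log_transfer hf.snd lq
  have lf₃ := d₃.integral_log_transfer hf lf
  have lp₃ := d₃.fst.integral_log_transfer hf.fst lp
  have hlogK : 0 ≤ Real.log K := Real.log_nonneg hK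
  simp only [mutualInfo] at hI
  refine ⟨?_, ?_, ?_⟩
  -- By the Markov property, the conditional density of `X₂` is almost surely `f (X₂, Y₁) / q (Y₁)`
  -- with `q` the density of `Y`.
  · have hae : ∀ᵐ ω ∂P', (∫⁻ y, chainDensity f ((X₂ ω, y), (X₁ ω, Y₁ ω))) / f (X₁ ω, Y₁ ω) =
        f (X₂ ω, Y₁ ω) / ∫⁻ x, f (x, Y₁ ω) := by
      filter_upwards [d₁.ae_pos_lt_top, d₁.fst.ae_pos_lt_top] with ω n₁ n₂
      have : ∫⁻ y, chainDensity f ((X₂ ω, y), (X₁ ω, Y₁ ω)) =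
          f (X₂ ω, Y₁ ω) / (∫⁻ x, f (x, Y₁ ω)) * f (X₁ ω, Y₁ ω) := by
        simp only [chainDensity]
        rw [lintegral_const_mul _ (by fun_prop)]
        simp only [div_eq_mul_inv]
        rw [lintegral_mul_const _ (by fun_prop), ENNReal.mul_inv_cancel n₂.1 n₂.2, mul_one]
      rw [this, ENNReal.mul_div_cancel_right n₁.1 n₁.2]
    have hlog : ∀ᵐ ω ∂P', Real.log (f (X₂ ω, Y₁ ω)).toReal -
        Real.log (∫⁻ x, f (x, Y₁ ω)).toReal =
        Real.log (f (X₂ ω, Y₁ ω) / ∫⁻ x, f (x, Y₁ ω)).toReal := by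
      filter_upwards [d₂.ae_toReal_ne_zero, d₂.snd.ae_toReal_ne_zero] with ω n₁ n₂
      rw [ENNReal.toReal_div, Real.log_div n₁ n₂]
    obtain ⟨hi, hc⟩ := integral_sub_of_eq lf₂ lq₂
    obtain ⟨hfin, heq⟩ := condDiffEntropy_of_density hW.fst_prodMk d₁ hae
      ((integrable_congr hlog).1 hi)
    refine ⟨hfin, ?_⟩
    rw [heq, ← integral_congr_ae hlog, hc]
    linarith
  -- Likewise the conditional density of `Y'` is `f (X₁, Y') / p (X₁)` with `p` the density of `X`.
  · have hae : ∀ᵐ ω ∂P', (∫⁻ x, chainDensity f ((x, Y' ω), (X₁ ω, Y₁ ω))) / f (X₁ ω, Y₁ ω) =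
        f (X₁ ω, Y' ω) / ∫⁻ y, f (X₁ ω, y) := by
      filter_upwards [d₁.ae_pos_lt_top, d₁.snd.ae_pos_lt_top] with ω n₁ n₂
      have : ∫⁻ x, chainDensity f ((x, Y' ω), (X₁ ω, Y₁ ω)) =
          f (X₁ ω, Y' ω) / (∫⁻ y, f (X₁ ω, y)) * f (X₁ ω, Y₁ ω) := by
        simp only [chainDensity]
        rw [lintegral_mul_const _ (by fun_prop), lintegral_mul_const _ (by fun_prop)]
        simp only [div_eq_mul_inv]
        rw [lintegral_mul_const _ (by fun_prop), ENNReal.mul_inv_cancel n₂.1 n₂.2, one_mul,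
          mul_comm]
      rw [this, ENNReal.mul_div_cancel_right n₁.1 n₁.2]
    have hlog : ∀ᵐ ω ∂P', Real.log (f (X₁ ω, Y' ω)).toReal -
        Real.log (∫⁻ y, f (X₁ ω, y)).toReal =
        Real.log (f (X₁ ω, Y' ω) / ∫⁻ y, f (X₁ ω, y)).toReal := by
      filter_upwards [d₃.ae_toReal_ne_zero, d₃.fst.ae_toReal_ne_zero] with ω n₁ n₂
      rw [ENNReal.toReal_div, Real.log_div n₁ n₂]
    obtain ⟨hi, hc⟩ := integral_sub_of_eq lf₃ lp₃
    obtain ⟨hfin, heq⟩ := condDiffEntropy_of_density hW.snd_prodMk d₁ hae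
      ((integrable_congr hlog).1 hi)
    refine ⟨hfin, ?_⟩
    rw [heq, ← integral_congr_ae hlog, hc]
    linarith
  · obtain ⟨hi, hle⟩ := integral_log_condSum d₂ d₁ d₃ hW dS
      (d₁.integral_log_transfer hf lf) (d₁.fst.integral_log_transfer hf.fst lp)
      (d₁.snd.integral_log_transfer hf.snd lq) (dS.integral_log_transfer hSd ls)
    have hZ : HasDensity (fun ω => (X₂ ω + Y' ω, (X₁ ω, Y₁ ω))) P' (sumDensity f) :=
      hW.shear.snd_prodMk
    obtain ⟨hfin, heq⟩ := condDiffEntropy_of_density hZ d₁ (.of_forall fun _ => rfl) hi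
    refine ⟨hfin, ?_⟩
    rw [heq]
    linarith
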